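/- Identify $\{0,1\}^{\mathbb N}$ with the set of all functions $h:\mathbb N\to\{0,1\}$. A hypothesis class is an arbitrary set $\mathcal H\subseteq\{0,1\}^{\mathbb N}$. A learner is a function $A:\bigcup_{m\in\mathbb N}(\mathbb N\times\{0,1\})^m\to\{0,1\}^{\mathbb N}$; it is computable if there is an algorithm that transforms every sample $S$ into a program that halts on every input and computes $A(S)$; it is proper for $\mathcal H$ if $A(S)\in\mathcal H$ for every $S$. For a probability distribution $D$ on $\mathbb N\times\{0,1\}$ put $L_D(h)=\Pr_{(x,y)\sim D}[h(x)\ne y]$. For integers $n\ge 1$ and $m\ge 0$ let $P(n,m)$ be the assertion that for every probability distribution $D$ on $\mathbb N\times\{0,1\}$ $$\Pr_{S\sim D^m}\Big[L_D(A(S))\le\inf_{h\in\mathcal H}L_D(h)+\tfrac1n\Big]\ge 1-\tfrac1n ,$$ where $\inf\emptyset=+\infty$. The learner $A$ PAC learns $\mathcal H$ if for every $n\ge1$ there is $M$ such that $P(n,m)$ holds for all $m\ge M$; the least such $M$, as a function of $n\ge1$, is the sample complexity of $A$ with respect to $\mathcal H$. The class $\mathcal H$ is CPAC learnable if some computable (not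 necessarily proper) learner PAC learns $\mathcal H$. It is properly SCPAC learnable if some computable learner that is proper for $\mathcal H$ PAC learns $\mathcal H$ with a sample complexity that is bounded from above by a total computable function. For $k\in\mathbb N$, a $k$-witness of VC dimension for $\mathcal H$ is a function $w$ that assigns to every tuple $x_1<\dots<x_{k+1}$ of natural numbers an element of $\{0,1\}^{k+1}$ such that $(h(x_1),\dots,h(x_{k+1}))\ne w(x_1,\dots,x_{k+1})$ for all $h\in\mathcal H$ and all $x_1<\dots<x_{k+1}$. The effective VC dimension of $\mathcal H$ is the least $k\in\mathbb N$ for which a computable $k$-witness exists, and $\infty$ if there is none. **Theorem.** For every hypothesis class $\mathcal H\subseteq\{0,1\}^{\mathbb N}$ the following are equivalent: (a) the effective VC dimension of $\mathcal H$ is finite; (b) $\mathcal H$ is CPAC learnable; (c) $\mathcal H$ is contained in some properly SCPAC learnable hypothesis class $\widehat{\mathcal H}\subseteq\{0,1\}^{\mathbb N}$. -/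

import Mathlib

open MeasureTheory
open scoped ENNReal

noncomputable section

namespace CPAC

/-- Hypotheses are arbitrary Boolean functions on the natural numbers. -/
abbrev Hypothesis : Type := ℕ → Bool

/-- A hypothesis class is an arbitrary set of hypotheses. -/
abbrev HypothesisClass : Type := Set Hypothesis

/-- Samples of all (finite) sizes: finite sequences of labelled points. -/
abbrev Sample : Type := List (ℕ × Bool)

/-- A learner maps every sample, of any size, to a function `ℕ → {0, 1}`. -/
abbrev Learner : Type := Sample → Hypothesis

/-- The generalization error `L_D(h) = Pr_{(x, y) ∼ D} [h(x) ≠ y]`. -/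
def genError (D : Measure (ℕ × Bool)) (h : Hypothesis) : ℝ≥0∞ :=
  D {p | h p.1 ≠ p.2}

/-- The learner `A`, run on samples of size `m`, meets the requirement with parameter `n` for the
class `H`: for every probability distribution `D` on `ℕ × {0, 1}`,
`Pr_{S ∼ D^m} [L_D(A(S)) ≤ inf_{h ∈ H} L_D(h) + 1/n] ≥ 1 - 1/n`.
The infimum is taken in `[0, ∞]`; it is `∞` when `H` is empty. -/
def Succeeds (A : Learner) (H : HypothesisClass) (n m : ℕ) : Prop :=
  ∀ D : Measure (ℕ × Bool), IsProbabilityMeasure D →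
    1 - 1 / (n : ℝ≥0∞) ≤
      Measure.pi (fun _ : Fin m => D)
        {S : Fin m → ℕ × Bool |
          genError D (A (List.ofFn S)) ≤ (⨅ h ∈ H, genError D h) + 1 / (n : ℝ≥0∞)}

/-- `A` PAC learns `H` (the parameter `n` ranges over the positive integers). -/
def PACLearns (A : Learner) (H : HypothesisClass) : Prop :=
  ∀ n : ℕ, 1 ≤ n → ∃ M : ℕ, ∀ m : ℕ, M ≤ m → Succeeds A H n m

/-- The sample complexity of `A` with respect to `H`: the least `M` such that `A` succeeds with
parameter `n` on all sample sizes `m ≥ M`. It is used only for positive `n` and for learners that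
PAC learn `H`, so that such an `M` exists. -/
def sampleComplexity (A : Learner) (H : HypothesisClass) (n : ℕ) : ℕ :=
  sInf {M : ℕ | ∀ m : ℕ, M ≤ m → Succeeds A H n m}

/-- A learner is computable if some algorithm transforms every sample `S` into a program (a code of
a partial recursive function) which halts on every input and computes the function `A(S)`. -/
def IsComputableLearner (A : Learner) : Prop :=
  ∃ c : Sample → Nat.Partrec.Code, Computable c ∧
    ∀ (S : Sample) (x : ℕ), (c S).eval x = Part.some (A S x).toNat

/-- A learner is proper for `H` if it outputs only hypotheses from `H`. -/
def IsProper (A : Learner) (H : HypothesisClass) : Prop :=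
  ∀ S : Sample, A S ∈ H

/-- CPAC learnability, with a possibly improper learner. -/
def CPACLearnable (H : HypothesisClass) : Prop :=
  ∃ A : Learner, IsComputableLearner A ∧ PACLearns A H

/-- Proper strong CPAC learnability: there is a computable learner, proper for `H`, that PAC learns
`H` with a sample complexity bounded by a total computable function. -/
def ProperlySCPACLearnable (H : HypothesisClass) : Prop :=
  ∃ A : Learner, IsComputableLearner A ∧ PACLearns A H ∧ IsProper A H ∧
    ∃ f : ℕ → ℕ, Computable f ∧ ∀ n : ℕ, 1 ≤ n → sampleComplexity A H n ≤ f n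

/-- `w` is a `k`-witness of VC dimension for `H`: to every increasing tuple
`x₁ < ⋯ < x_{k+1}` of natural numbers it assigns an element of `{0, 1}^{k+1}` which differs from
`(h(x₁), …, h(x_{k+1}))` for all `h ∈ H`. An increasing tuple is an order embedding of
`Fin (k + 1)` into `ℕ`. -/
def IsWitness (H : HypothesisClass) (k : ℕ)
    (w : (Fin (k + 1) ↪o ℕ) → (Fin (k + 1) → Bool)) : Prop :=
  ∀ x : Fin (k + 1) ↪o ℕ, ∀ h ∈ H, (fun i => h (x i)) ≠ w x

/-- A function defined on increasing tuples is computable if some algorithm, given any increasing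
tuple, halts and returns the value of the function (its behaviour on tuples that are not increasing
is irrelevant). -/
def IsComputableOnTuples {k : ℕ}
    (w : (Fin (k + 1) ↪o ℕ) → (Fin (k + 1) → Bool)) : Prop :=
  ∃ W : (Fin (k + 1) → ℕ) →. (Fin (k + 1) → Bool), Partrec W ∧
    ∀ x : Fin (k + 1) ↪o ℕ, W (fun i => x i) = Part.some (w x)

/-- There is a computable `k`-witness of VC dimension for `H`. -/
def HasComputableWitness (H : HypothesisClass) (k : ℕ) : Prop :=
  ∃ w : (Fin (k + 1) ↪o ℕ) → (Fin (k + 1) → Bool),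
    IsWitness H k w ∧ IsComputableOnTuples w

/-- The effective VC dimension: the least `k` for which there is a computable `k`-witness, and `∞`
if there is no such `k`. -/
def effectiveVCDim (H : HypothesisClass) : ℕ∞ :=
  ⨅ (k : ℕ) (_ : HasComputableWitness H k), (k : ℕ∞)

end CPAC

end

/-! The proof runs (a) ⇒ (c) ⇒ (b) ⇒ (a).

(a) ⇒ (c). Let `W` be a computable witness on tuples of k + 1 points. Avoiding `W` everywhere is too
strict a condition for an effective learner: cutting a hypothesis off to a finitely supported one
may violate it. `forcedClass W` therefore demands avoidance only below a later point labelled 1. It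
contains the original class, it cannot shatter k + 2 points, it is closed under truncation, and
membership of a finitely supported hypothesis is decidable. Hence a finite search minimizes the
empirical error exactly and properly (`isERM_forcedLearner`). Finite VC dimension makes every such
minimizer a PAC learner with an explicit polynomial sample size (`IsERM.succeeds_of_sampleSize_le`),
by symmetrization, the Sauer–Shelah bound and an exponential tail bound for random signs.

(c) ⇒ (b). A learner for a class learns every subclass.

(b) ⇒ (a). By the no-free-lunch argument (`exists_labels_quarter_le_lintegral`), on any 2m + 2
points some labelling forces expected error at least 1/4 on a learner that sees m examples. A
learner that succeeds with parameter 9 has expected error at most 2/9 on labellings realized by the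
class, so the bad labelling is not realized. Finding it takes finitely many output bits of the
learner, so it is a computable witness. -/

noncomputable section

namespace CPAC

/-! ### Computability of finite tables, bounded quantifiers and learners -/

section Computability

variable {α β : Type*} [Primcodable α] [Primcodable β]

theorem computable_fin_lam {n : ℕ} {f : α → Fin n → β} (hf : ∀ i, Computable fun a => f a i) :
    Computable f := by
  have h1 : Computable fun a => List.Vector.ofFn fun i => f a i := Computable.vector_ofFn hf
  have h2 : Computable fun v : List.Vector β n => v.get :=
    (Primrec.fin_curry.2 Primrec.vector_get).to_comp
  exact (h2.comp h1).of_eq fun a => by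
    funext i; simp

theorem computable_fin_apply {n : ℕ} {f : α → Fin n → β} (hf : Computable f) (i : Fin n) :
    Computable fun a => f a i :=
  (Computable.fin_app.comp hf (Computable.const i) :)

/-- A function of finitely many computable bits is computable. -/
theorem computable_of_table {ι : Type*} [Finite ι] {f : ι → α → Bool}
    (hf : ∀ i, Computable (f i)) (F : (ι → Bool) → β) : Computable fun a => F fun i => f i a := by
  obtain ⟨n, ⟨e⟩⟩ := Finite.exists_equiv_fin ι
  have h1 : Computable fun a => fun j : Fin n => f (e.symm j) a :=
    computable_fin_lam fun j => hf (e.symm j)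
  have h2 : Computable fun g : Fin n → Bool => F fun i => g (e i) :=
    (Primrec.dom_finite _).to_comp
  exact (h2.comp h1).of_eq fun a => by simp

theorem computable_decide_forall_lt {p : α → ℕ → Bool} (hp : Computable₂ p) {f : α → ℕ}
    (hf : Computable f) : Computable fun a => decide (∀ x < f a, p a x = true) := by
  have h : Computable fun a => (Nat.rec true (fun x b => b && p a x) (f a) : Bool) :=
    Computable.nat_rec hf (Computable.const true)
      ((Primrec.and.to_comp.comp (Computable.snd.comp Computable.snd)
        (hp.comp Computable.fst (Computable.fst.comp Computable.snd))).to₂)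
  refine h.of_eq fun a => ?_
  generalize f a = n
  induction n with
  | zero => simp
  | succ n ih =>
    rw [Bool.eq_iff_iff]
    simp only [ih, Bool.and_eq_true, decide_eq_true_eq, Nat.lt_succ_iff_lt_or_eq]
    grind

-- The accumulator `acc` makes the induction go through: the last entry of `l` is moved onto it,
-- leaving a quantifier over shorter lists.
open scoped Classical in
theorem computable_decide_forall_list {p : α → List ℕ → Bool} (hp : Computable₂ p) {f : α → ℕ}
    (hf : Computable f) (n : ℕ) : Computable₂ fun a acc =>
      decide (∀ l : List ℕ, l.length = n → (∀ x ∈ l, x < f a) → p a (l ++ acc) = true) := by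
  induction n with
  | zero => exact hp.of_eq fun a => by simp
  | succ n ih =>
    have h : Computable fun q : α × List ℕ => decide (∀ x < f q.1, decide (∀ l : List ℕ,
        l.length = n → (∀ y ∈ l, y < f q.1) → p q.1 (l ++ (x :: q.2)) = true) = true) :=
      computable_decide_forall_lt
        (p := fun (q : α × List ℕ) x => decide (∀ l : List ℕ,
          l.length = n → (∀ y ∈ l, y < f q.1) → p q.1 (l ++ (x :: q.2)) = true))
        ((ih.comp (Computable.fst.comp Computable.fst)
          (Computable.list_cons.comp Computable.snd (Computable.snd.comp Computable.fst))).to₂)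
        (hf.comp Computable.fst)
    refine h.of_eq fun q => ?_
    rw [Bool.eq_iff_iff]
    simp only [decide_eq_true_eq]
    constructor
    · intro H l hl hx
      obtain ⟨l', x, rfl⟩ := List.eq_nil_or_concat' l |>.resolve_left (by rintro rfl; simp at hl)
      have := H x (hx x (by simp)) l' (by simpa using hl) (fun y hy => hx y (by simp [hy]))
      simpa using this
    · intro H x hx l hl hy
      have := H (l ++ [x]) (by simp [hl]) (fun y hy' => by
        rcases List.mem_append.1 hy' with h | h
        · exact hy y h
        · rw [List.mem_singleton.1 h]; exact hx)
      simpa using this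

open scoped Classical in
theorem computable_decide_forall_fin {n : ℕ} {p : α → (Fin n → ℕ) → Bool} (hp : Computable₂ p)
    {f : α → ℕ} (hf : Computable f) : Computable fun a =>
      decide (∀ z : Fin n → ℕ, (∀ i, z i < f a) → p a z = true) := by
  have hz : Computable fun l : List ℕ => fun i : Fin n => l[(i : ℕ)]?.getD 0 :=
    computable_fin_lam fun i => Computable.option_getD
      (Computable.list_getElem?.comp Computable.id (Computable.const _)) (Computable.const _)
  have hp' : Computable₂ fun a (l : List ℕ) => p a fun i : Fin n => l[(i : ℕ)]?.getD 0 :=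
    (hp.comp Computable.fst (hz.comp Computable.snd)).to₂
  refine ((computable_decide_forall_list hp' hf n).comp Computable.id
    (Computable.const [])).of_eq fun a => ?_
  rw [Bool.eq_iff_iff]
  simp only [decide_eq_true_eq, List.append_nil, id]
  constructor
  · intro H z hz
    simpa using H (List.ofFn z) (by simp) (by simpa [List.mem_ofFn] using hz)
  · intro H l hl hx
    refine H _ fun i => ?_
    have : (i : ℕ) < l.length := by rw [hl]; exact i.2
    simpa [this] using hx _ (List.getElem_mem this)

theorem primrec_two_pow : Primrec fun n : ℕ => 2 ^ n :=
  (Primrec.nat_rec₁ 1 ((Primrec.nat_mul.comp (Primrec.const 2) Primrec.snd).to₂)).of_eq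
    fun n => by induction n with
      | zero => rfl
      | succ n ih => rw [pow_succ', ← ih]

theorem primrec_testBit : Primrec₂ Nat.testBit := by
  have h : Primrec fun p : ℕ × ℕ => (p.1 / 2 ^ p.2).bodd :=
    Primrec.nat_bodd.comp (Primrec.nat_div.comp Primrec.fst (primrec_two_pow.comp Primrec.snd))
  refine h.of_eq fun p => ?_
  rw [Nat.testBit_eq_decide_div_mod_eq, Nat.mod_two_of_bodd]
  cases Nat.bodd _ <;> rfl

/-- A learner whose outputs are uniformly computable is a computable learner. -/
theorem isComputableLearner_of_computable₂ {A : Learner} (hA : Computable₂ A) :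
    IsComputableLearner A := by
  have h : Computable fun n : ℕ => ((Encodable.decode (α := Sample × ℕ) n).map
      fun q => (A q.1 q.2).toNat).getD 0 := by
    refine Computable.option_getD (Computable.option_map Computable.decode ?_) (Computable.const 0)
    have : Computable Bool.toNat := (Primrec.dom_finite _).to_comp
    exact (this.comp (hA.comp (Computable.fst.comp Computable.snd)
      (Computable.snd.comp Computable.snd))).to₂
  obtain ⟨c, hc⟩ := Nat.Partrec.Code.exists_code.1 (Partrec.nat_iff.1 h)
  -- The s-m-n theorem: one code for the two-argument function, with the sample hard-wired as first
  -- argument.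
  refine ⟨fun S => c.curry (Encodable.encode S),
    (Nat.Partrec.Code.primrec₂_curry.to_comp.comp (Computable.const c)
      (Computable.encode (α := Sample)) :), ?_⟩
  intro S x
  rw [Nat.Partrec.Code.eval_curry, hc]
  have : Nat.pair (Encodable.encode S) x = Encodable.encode (S, x) := by simp
  rw [this]
  simp only [PFun.coe_val, Encodable.encodek]
  rfl

theorem IsComputableLearner.computable₂ {A : Learner} (hA : IsComputableLearner A) :
    Computable₂ A := by
  obtain ⟨c, hc, h⟩ := hA
  have h1 : Partrec fun q : Sample × ℕ => (c q.1).eval q.2 :=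
    Nat.Partrec.Code.eval_part.comp (hc.comp Computable.fst) Computable.snd
  have h2 : Computable fun q : Sample × ℕ => (A q.1 q.2).toNat :=
    h1.of_eq fun q => h q.1 q.2
  have h3 : Computable fun n : ℕ => decide (n ≠ 0) :=
    (PrimrecPred.decide
      (Primrec.eq.comp (Primrec.id (α := ℕ)) (Primrec.const 0)).not).to_comp
  exact (h3.comp h2).of_eq fun q => by cases A q.1 q.2 <;> rfl

end Computability

/-! ### No free lunch: from a computable learner to a computable witness -/

section NoFreeLunch

/-- Flipping the label at the unseen point `j` does not change the guess, so it injects the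
labellings guessed correctly into those guessed wrongly. -/
theorem two_pow_le_two_mul_card_label_ne {K m : ℕ} (g : (Fin m → Bool) → Bool)
    (σ : Fin m → Fin K) {j : Fin K} (hj : j ∉ Set.range σ) :
    2 ^ K ≤ 2 * (Finset.univ.filter fun w : Fin K → Bool => g (w ∘ σ) ≠ w j).card := by
  classical
  set s := Finset.univ.filter fun w : Fin K → Bool => g (w ∘ σ) ≠ w j with hs
  have hinj : Function.Injective fun w : Fin K → Bool => Function.update w j (!w j) := by
    intro w w' h
    have hj' : w j = w' j := by simpa using congrFun h j
    funext i
    by_cases hi : i = j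
    · rw [hi, hj']
    · simpa [hi] using congrFun h i
  have hc : sᶜ.card ≤ s.card := by
    refine Finset.card_le_card_of_injOn (fun w => Function.update w j (!w j)) ?_ hinj.injOn
    intro w hw
    have hσ : Function.update w j (!w j) ∘ σ = w ∘ σ := by
      funext i
      simp only [Function.comp]
      exact Function.update_of_ne (fun h => hj ⟨i, h⟩) _ _
    simp only [hs, Finset.compl_filter, Finset.coe_filter, Set.mem_ofPred_eq, Finset.mem_univ,
      true_and, not_not] at hw
    simp [hs, hσ, hw]
  have := Finset.card_add_card_compl s
  have hcard : Fintype.card (Fin K → Bool) = 2 ^ K := by simp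
  omega

/-- The uniform distribution on `Fin K`. -/
abbrev unif (K : ℕ) : Measure (Fin K) := ProbabilityTheory.uniformOn Set.univ

theorem half_le_unif_compl_range {m : ℕ} (σ : Fin m → Fin (2 * m + 2)) :
    (1 / 2 : ℝ≥0∞) ≤ unif (2 * m + 2) (Set.range σ)ᶜ := by
  classical
  rw [ProbabilityTheory.uniformOn_univ]
  have h1 : (Set.range σ)ᶜ = ((Finset.univ.image σ)ᶜ : Finset (Fin (2 * m + 2))) := by simp
  have h2 : m + 1 ≤ ((Finset.univ.image σ)ᶜ : Finset (Fin (2 * m + 2))).card := by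
    have := Finset.card_image_le (s := Finset.univ) (f := σ)
    rw [Finset.card_compl]
    simp at this ⊢
    omega
  rw [h1, Measure.count_apply_finset]
  rw [ENNReal.le_div_iff_mul_le (by simp) (by simp)]
  calc (1 / 2 : ℝ≥0∞) * (Fintype.card (Fin (2 * m + 2)) : ℝ≥0∞)
      = ((m + 1 : ℕ) : ℝ≥0∞) := by
        rw [Fintype.card_fin, show 2 * m + 2 = 2 * (m + 1) by ring, Nat.cast_mul, ← mul_assoc]
        simp [ENNReal.inv_mul_cancel]
    _ ≤ _ := by exact_mod_cast h2

/-- Average over all labellings: a draw of m points misses at least half of the `K` points, and at a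
missed point half of the labellings or more are guessed wrongly. The mean expected error is thus at
least 1/4. -/
theorem exists_labels_quarter_le_lintegral {m K : ℕ} (hK : K = 2 * m + 2)
    (g : (Fin m → Fin K) → (Fin m → Bool) → Fin K → Bool) :
    ∃ w : Fin K → Bool, (1 / 4 : ℝ≥0∞) ≤
      ∫⁻ σ, unif K {j | g σ (w ∘ σ) j ≠ w j} ∂(Measure.pi fun _ : Fin m => unif K) := by
  classical
  have : NeZero K := ⟨by omega⟩
  set μ := Measure.pi fun _ : Fin m => unif K
  by_contra! hcon
  have key : (2 ^ K / 2 : ℝ≥0∞) * (1 / 2) ≤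
      ∑ w : Fin K → Bool, ∫⁻ σ, unif K {j | g σ (w ∘ σ) j ≠ w j} ∂μ := by
    rw [← lintegral_finsetSum _ fun _ _ => Measurable.of_discrete]
    calc (2 ^ K / 2 : ℝ≥0∞) * (1 / 2)
        = ∫⁻ _ : Fin m → Fin K, (2 ^ K / 2 : ℝ≥0∞) * (1 / 2) ∂μ := by simp
      _ ≤ _ := lintegral_mono fun σ => ?_
    calc (2 ^ K / 2 : ℝ≥0∞) * (1 / 2)
        ≤ (2 ^ K / 2 : ℝ≥0∞) * unif K (Set.range σ)ᶜ := by
          gcongr; subst hK; exact half_le_unif_compl_range σ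
      _ = ∫⁻ j, (2 ^ K / 2 : ℝ≥0∞) * (Set.range σ)ᶜ.indicator 1 j ∂unif K := by
          rw [lintegral_const_mul _ Measurable.of_discrete, lintegral_indicator_one .of_discrete]
      _ ≤ ∫⁻ j, ∑ w : Fin K → Bool, {j | g σ (w ∘ σ) j ≠ w j}.indicator 1 j ∂unif K := by
          refine lintegral_mono fun j => ?_
          by_cases hj : j ∈ Set.range σ
          · simp [hj]
          · rw [Set.indicator_of_mem (by simpa using hj)]
            have := two_pow_le_two_mul_card_label_ne (fun v => g σ v j) σ hj
            simp only [Set.indicator_apply, Set.mem_ofPred_eq, Pi.one_apply, mul_one,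
              Finset.sum_boole]
            refine ENNReal.div_le_of_le_mul' ?_
            exact_mod_cast this
      _ = _ := by
          rw [lintegral_finsetSum _ fun _ _ => Measurable.of_discrete]
          exact Finset.sum_congr rfl fun w _ => lintegral_indicator_one .of_discrete
  have h2 : ∑ w : Fin K → Bool, ∫⁻ σ, unif K {j | g σ (w ∘ σ) j ≠ w j} ∂μ <
      ∑ w : Fin K → Bool, (1 / 4 : ℝ≥0∞) :=
    ENNReal.sum_lt_sum_of_nonempty Finset.univ_nonempty fun w _ => hcon w
  refine (key.trans_lt h2).ne ?_
  simp only [Finset.sum_const, Finset.card_univ, Fintype.card_fun, Fintype.card_bool,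
    Fintype.card_fin, nsmul_eq_mul, Nat.cast_pow, Nat.cast_ofNat]
  rw [div_eq_mul_inv, mul_assoc, one_div, one_div, ← ENNReal.mul_inv (by simp) (by simp)]
  norm_num

/-- The labelled sample drawn at the positions `σ` from the points `x` with labels `v`. -/
def drawn {K m : ℕ} (x : Fin K → ℕ) (σ : Fin m → Fin K) (v : Fin m → Bool) : Sample :=
  List.ofFn fun i => (x (σ i), v i)

/-- For the uniform distribution on the points labelled by `h` the infimum is 0. The error is at
most 1/n on the good event and at most 1 off it, which has probability at most 1/n. -/
theorem lintegral_error_le_of_succeeds {A : Learner} {H : HypothesisClass} {n m K : ℕ} [NeZero K]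
    (hA : Succeeds A H n m) (x : Fin K → ℕ) {h : Hypothesis} (hH : h ∈ H) :
    ∫⁻ σ, unif K {j | A (drawn x σ ((fun j => h (x j)) ∘ σ)) (x j) ≠ h (x j)}
        ∂(Measure.pi fun _ : Fin m => unif K) ≤ 2 / (n : ℝ≥0∞) := by
  set μ := Measure.pi fun _ : Fin m => unif K
  let φ : Fin K → ℕ × Bool := fun j => (x j, h (x j))
  have hφ : Measurable φ := Measurable.of_discrete
  let D := (unif K).map φ
  have hD : IsProbabilityMeasure D := Measure.isProbabilityMeasure_map hφ.aemeasurable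
  have hpi : Measure.pi (fun _ : Fin m => D) = μ.map fun σ i => φ (σ i) :=
    (Measure.pi_map_pi fun _ => hφ.aemeasurable).symm
  have herr : ∀ f : Hypothesis, genError D f = unif K {j | f (x j) ≠ h (x j)} := fun f => by
    rw [genError, Measure.map_apply hφ (Set.to_countable _).measurableSet]; rfl
  have hinf : (⨅ f ∈ H, genError D f) = 0 := by
    refine le_antisymm ((iInf₂_le h hH).trans ?_) bot_le
    rw [herr]; simp
  have hs := hA D hD
  rw [hpi, hinf, zero_add, Measure.map_apply .of_discrete (Set.to_countable _).measurableSet] at hs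
  set G : Set (Fin m → Fin K) := (fun σ i => φ (σ i)) ⁻¹' {S : Fin m → ℕ × Bool |
          genError D (A (List.ofFn S)) ≤ 1 / (n : ℝ≥0∞)} with hG
  have hGc : μ Gᶜ ≤ 1 / n := by
    rw [prob_compl_eq_one_sub .of_discrete]
    exact tsub_le_iff_tsub_le.1 hs
  calc ∫⁻ σ, unif K {j | A (drawn x σ ((fun j => h (x j)) ∘ σ)) (x j) ≠ h (x j)} ∂μ
      ≤ ∫⁻ σ, (1 / (n : ℝ≥0∞) + Gᶜ.indicator 1 σ) ∂μ := by
        refine lintegral_mono fun σ => ?_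
        by_cases hσ : σ ∈ G
        · have : genError D (A (List.ofFn fun i => φ (σ i))) ≤ 1 / (n : ℝ≥0∞) := hσ
          rw [herr] at this
          exact this.trans le_self_add
        · rw [Set.indicator_of_mem (by simpa using hσ)]
          exact prob_le_one.trans le_add_self
    _ = 1 / n + μ Gᶜ := by
        rw [lintegral_add_left .of_discrete, lintegral_indicator_one .of_discrete]; simp
    _ ≤ 1 / n + 1 / n := by gcongr
    _ = 2 / n := by rw [← ENNReal.add_div]; norm_num

/-- A class with a computable PAC learner has a computable witness of VC dimension. -/
theorem CPACLearnable.exists_hasComputableWitness {H : HypothesisClass} (hH : CPACLearnable H) :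
    ∃ k, HasComputableWitness H k := by
  classical
  obtain ⟨A, hAc, hA⟩ := hH
  -- 9 is the least n with 2/n < 1/4.
  obtain ⟨m, hm⟩ := hA 9 (by norm_num)
  have hm := hm m le_rfl
  have hAc := hAc.computable₂
  have hw := fun g => exists_labels_quarter_le_lintegral (m := m) rfl g
  -- `F` comes from choice, but its argument ranges over a finite type, so it is a finite look-up
  -- table and harmless for computability.
  choose F hF using hw
  let bit : (Fin m → Fin (2 * m + 2)) × (Fin m → Bool) × Fin (2 * m + 2) →
      (Fin (2 * m + 2) → ℕ) → Bool := fun q x => A (drawn x q.1 q.2.1) (x q.2.2)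
  let W : (Fin (2 * m + 2) → ℕ) → Fin (2 * m + 2) → Bool :=
    fun x => F fun σ v j => bit (σ, v, j) x
  refine ⟨2 * m + 1, fun x => W x, ?_, fun x => Part.some (W x), ?_, fun x => rfl⟩
  · intro x h hh heq
    have h1 := lintegral_error_le_of_succeeds hm x hh
    have h2 := hF fun σ v j => bit (σ, v, j) x
    change _ ≤ ∫⁻ σ, unif (2 * m + 2) {j | A (drawn x σ (W x ∘ σ)) (x j) ≠ W x j} ∂_ at h2
    have heq' : W x = fun i => h (x i) := heq.symm
    rw [heq'] at h2
    have h3 := h2.trans h1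
    have h4 := (ENNReal.toReal_le_toReal (by simp) (by simp [ENNReal.div_eq_top])).2 h3
    norm_num at h4
  · have hbit : ∀ q, Computable (bit q) := fun q => by
      refine hAc.comp ?_ (computable_fin_apply Computable.id _)
      exact Computable.list_ofFn fun i =>
        (computable_fin_apply Computable.id _).pair (Computable.const _)
    exact computable_of_table hbit fun T => F fun σ v j => T (σ, v, j)

end NoFreeLunch

/-! ### Finite effective dimension, and passage to subclasses -/

theorem effectiveVCDim_lt_top {H : HypothesisClass} :
    effectiveVCDim H < ⊤ ↔ ∃ k, HasComputableWitness H k := by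
  simp [effectiveVCDim, iInf_lt_iff]

theorem Succeeds.mono {A : Learner} {H H' : HypothesisClass} {n m : ℕ} (h : Succeeds A H' n m)
    (hH : H ⊆ H') : Succeeds A H n m := fun D hD =>
  (h D hD).trans <| measure_mono fun S hS => by
    refine le_trans (b := (⨅ h ∈ H', genError D h) + 1 / (n : ℝ≥0∞)) hS ?_
    exact add_le_add (biInf_mono hH) le_rfl

theorem CPACLearnable.of_subset_of_properlySCPACLearnable {H H' : HypothesisClass} (hH : H ⊆ H')
    (h : ProperlySCPACLearnable H') : CPACLearnable H := by
  obtain ⟨A, hA, hP, -⟩ := h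
  refine ⟨A, hA, fun n hn => ?_⟩
  obtain ⟨M, hM⟩ := hP n hn
  exact ⟨M, fun m hm => (hM m hm).mono hH⟩

/-! ### A tail bound for sums of random signs -/

section Rademacher

/-- The sign `±1` of a bit. -/
def sgn (b : Bool) : ℝ := if b then 1 else -1

/-- Chernoff's method with exponent parameter `ε`: the moment generating function factors over the
coordinates, and cosh x ≤ exp(x²/2). -/
theorem card_sgn_sum_gt_le {ι : Type*} [Fintype ι] [DecidableEq ι] {v : ι → ℝ} (hv : ∀ i, |v i| ≤ 1) {ε : ℝ}
    (hε : 0 ≤ ε) :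
    ((Finset.univ.filter fun σ : ι → Bool =>
        ε * Fintype.card ι < ∑ i, sgn (σ i) * v i).card : ℝ) ≤
      2 ^ Fintype.card ι * Real.exp (-(ε ^ 2 * Fintype.card ι / 2)) := by
  set N := Fintype.card ι
  have hmgf : ∑ σ : ι → Bool, Real.exp (ε * ∑ i, sgn (σ i) * v i) ≤
      2 ^ N * Real.exp (ε ^ 2 * N / 2) := by
    calc ∑ σ : ι → Bool, Real.exp (ε * ∑ i, sgn (σ i) * v i)
        = ∑ σ : ι → Bool, ∏ i, Real.exp (ε * (sgn (σ i) * v i)) := by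
          simp_rw [Finset.mul_sum, Real.exp_sum]
      _ = ∏ i, ∑ b : Bool, Real.exp (ε * (sgn b * v i)) := by
          rw [Finset.prod_univ_sum, Fintype.piFinset_univ]
      _ ≤ ∏ _i : ι, 2 * Real.exp (ε ^ 2 / 2) := by
          refine Finset.prod_le_prod (fun i _ => by positivity) fun i _ => ?_
          have h1 : ∑ b : Bool, Real.exp (ε * (sgn b * v i)) = 2 * Real.cosh (ε * v i) := by
            rw [Real.cosh_eq]; simp [sgn]; ring
          rw [h1]
          gcongr
          refine (Real.cosh_le_exp_half_sq _).trans (Real.exp_le_exp.2 ?_)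
          have : v i ^ 2 ≤ 1 := (sq_le_one_iff_abs_le_one _).2 (hv i)
          rw [mul_pow]
          nlinarith [sq_nonneg ε]
      _ = 2 ^ N * Real.exp (ε ^ 2 * N / 2) := by
          rw [Finset.prod_const, mul_pow, ← Real.exp_nat_mul, Finset.card_univ]
          congr 2; ring
  have hmarkov : ((Finset.univ.filter fun σ : ι → Bool =>
        ε * N < ∑ i, sgn (σ i) * v i).card : ℝ) * Real.exp (ε ^ 2 * N) ≤
      ∑ σ : ι → Bool, Real.exp (ε * ∑ i, sgn (σ i) * v i) := by
    rw [← nsmul_eq_mul]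
    refine (Finset.card_nsmul_le_sum _ _ _ fun σ hσ => ?_).trans
      (Finset.sum_le_sum_of_subset_of_nonneg (Finset.filter_subset _ _)
        fun _ _ _ => (Real.exp_pos _).le)
    refine Real.exp_le_exp.2 ?_
    have := (Finset.mem_filter.1 hσ).2.le
    nlinarith
  have h := hmarkov.trans hmgf
  rw [← le_div_iff₀ (Real.exp_pos _)] at h
  refine h.trans_eq ?_
  rw [mul_div_assoc, ← Real.exp_sub]
  congr 2; ring

end Rademacher

/-! ### The Sauer–Shelah bound -/

section Traces

/-- No set of `d` points is shattered by `H`. -/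
def NotShattered (H : HypothesisClass) (d : ℕ) : Prop :=
  ∀ s : Finset ℕ, s.card = d → ∃ t ⊆ s, ∀ h ∈ H, s.filter (fun x => h x = true) ≠ t

open scoped Classical in
/-- The traces of the hypotheses of `H` on `P`. -/
def traces (H : HypothesisClass) (P : Finset ℕ) : Finset (Finset ℕ) :=
  P.powerset.filter fun t => ∃ h ∈ H, P.filter (fun x => h x = true) = t

/-- A set family has at most as many members as it shatters sets, and the shattered sets here have
at most `d` elements. -/
theorem card_traces_le {H : HypothesisClass} {d : ℕ} (hd : NotShattered H (d + 1))
    (P : Finset ℕ) : (traces H P).card ≤ (d + 1) * (P.card + 1) ^ d := by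
  classical
  refine (Finset.card_le_card_shatterer _).trans ?_
  have hsub : (traces H P).shatterer ⊆ (Finset.range (d + 1)).biUnion fun i => P.powersetCard i := by
    intro s hs
    have hs := Finset.mem_shatterer.1 hs
    obtain ⟨t, ht, hst⟩ := hs.exists_superset
    have hsP : s ⊆ P := hst.trans (Finset.mem_powerset.1 (Finset.mem_filter.1 ht).1)
    simp only [Finset.mem_biUnion, Finset.mem_range, Finset.mem_powersetCard]
    refine ⟨s.card, ?_, hsP, rfl⟩
    by_contra! hcard
    obtain ⟨s', hs', hc⟩ := Finset.exists_subset_card_eq hcard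
    obtain ⟨u, hu, hno⟩ := hd s' hc
    obtain ⟨r, hr, hru⟩ := (hs.mono_right hs') hu
    obtain ⟨h, hh, rfl⟩ := (Finset.mem_filter.1 hr).2
    refine hno h hh ?_
    rw [← hru, ← Finset.filter_mem_eq_inter]
    refine Finset.filter_congr fun x hx => ?_
    simp [hsP (hs' hx)]
  refine (Finset.card_le_card hsub).trans (Finset.card_biUnion_le.trans ?_)
  simp_rw [Finset.card_powersetCard]
  calc ∑ i ∈ Finset.range (d + 1), P.card.choose i
      ≤ ∑ i ∈ Finset.range (d + 1), (P.card + 1) ^ d := by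
        refine Finset.sum_le_sum fun i hi => ?_
        calc P.card.choose i ≤ P.card ^ i := Nat.choose_le_pow _ _
          _ ≤ (P.card + 1) ^ i := Nat.pow_le_pow_left (Nat.le_succ _) _
          _ ≤ (P.card + 1) ^ d :=
            Nat.pow_le_pow_right (Nat.succ_pos _) (Nat.lt_succ_iff.1 (Finset.mem_range.1 hi))
    _ = _ := by simp

end Traces

/-! ### Symmetrization with a ghost sample -/

section Symmetrization

/-- The zero-one loss of `h` at a labelled point. -/
def loss (h : Hypothesis) (p : ℕ × Bool) : ℕ := (h p.1 ^^ p.2).toNat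

theorem loss_le_one (h : Hypothesis) (p : ℕ × Bool) : loss h p ≤ 1 := Bool.toNat_le _

/-- The loss on the ghost point minus the loss on the actual point. -/
def lossGap (h : Hypothesis) (q : (ℕ × Bool) × (ℕ × Bool)) : ℝ := loss h q.2 - loss h q.1

theorem abs_lossGap_le_one (h : Hypothesis) (q : (ℕ × Bool) × (ℕ × Bool)) :
    |lossGap h q| ≤ 1 := by
  have h1 : (loss h q.1 : ℝ) ≤ 1 := by exact_mod_cast loss_le_one h q.1
  have h2 : (loss h q.2 : ℝ) ≤ 1 := by exact_mod_cast loss_le_one h q.2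
  have h3 : (0 : ℝ) ≤ loss h q.1 := Nat.cast_nonneg _
  have h4 : (0 : ℝ) ≤ loss h q.2 := Nat.cast_nonneg _
  rw [lossGap, abs_le]; constructor <;> linarith

/-- The double samples on which the error of some hypothesis of `H` on the ghost sample exceeds its
error on the actual sample by more than `ε`. -/
def badDouble (H : HypothesisClass) (ε : ℝ) (m : ℕ) : Set (Fin m → (ℕ × Bool) × (ℕ × Bool)) :=
  {T | ∃ h ∈ H, ε * m < ∑ i, lossGap h (T i)}

/-- Swap the two components of a pair unless the bit is set. -/
def swapUnless {X : Type*} (b : Bool) (q : X × X) : X × X := if b then q else q.swap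

theorem lossGap_swapUnless (h : Hypothesis) (b : Bool) (q : (ℕ × Bool) × (ℕ × Bool)) :
    lossGap h (swapUnless b q) = sgn b * lossGap h q := by
  cases b <;> simp [swapUnless, lossGap, sgn]

-- With `T` fixed, only the trace of a hypothesis on its at most 2m points matters, so a union bound
-- over traces reduces the count to the random-sign bound.
open scoped Classical in
theorem card_swap_mem_badDouble_le {H : HypothesisClass} {d : ℕ} (hd : NotShattered H (d + 1))
    {ε : ℝ} (hε : 0 ≤ ε) {m : ℕ} (T : Fin m → (ℕ × Bool) × (ℕ × Bool)) :
    ((Finset.univ.filter fun σ : Fin m → Bool =>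
        (fun i => swapUnless (σ i) (T i)) ∈ badDouble H ε m).card : ℝ) ≤
      (d + 1) * (2 * m + 1) ^ d * (2 ^ m * Real.exp (-(ε ^ 2 * m / 2))) := by
  let P : Finset ℕ := Finset.univ.image (fun i => (T i).1.1) ∪ Finset.univ.image fun i => (T i).2.1
  have hP : P.card ≤ 2 * m := by
    refine (Finset.card_union_le _ _).trans ?_
    have h1 := Finset.card_image_le (s := Finset.univ) (f := fun i => (T i).1.1)
    have h2 := Finset.card_image_le (s := Finset.univ) (f := fun i => (T i).2.1)
    simp only [Finset.card_univ, Fintype.card_fin] at h1 h2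
    omega
  let ind : Finset ℕ → Hypothesis := fun t x => decide (x ∈ t)
  let B : Finset ℕ → Finset (Fin m → Bool) := fun t => Finset.univ.filter fun σ =>
    ε * Fintype.card (Fin m) < ∑ i, sgn (σ i) * lossGap (ind t) (T i)
  have hsub : (Finset.univ.filter fun σ : Fin m → Bool =>
      (fun i => swapUnless (σ i) (T i)) ∈ badDouble H ε m) ⊆ (traces H P).biUnion B := by
    intro σ hσ
    obtain ⟨h, hh, hlt⟩ := (Finset.mem_filter.1 hσ).2
    refine Finset.mem_biUnion.2 ⟨P.filter fun x => h x = true, ?_, ?_⟩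
    · exact Finset.mem_filter.2 ⟨Finset.mem_powerset.2 (Finset.filter_subset _ _), h, hh, rfl⟩
    · refine Finset.mem_filter.2 ⟨Finset.mem_univ _, ?_⟩
      simp only [lossGap_swapUnless] at hlt
      rw [Fintype.card_fin]
      refine hlt.trans_eq (Finset.sum_congr rfl fun i _ => ?_)
      have h1 : (T i).1.1 ∈ P := by simp [P]
      have h2 : (T i).2.1 ∈ P := by simp [P]
      simp [lossGap, loss, ind, h1, h2]
  calc _ ≤ (((traces H P).biUnion B).card : ℝ) := by exact_mod_cast Finset.card_le_card hsub
    _ ≤ ∑ t ∈ traces H P, ((B t).card : ℝ) := by exact_mod_cast Finset.card_biUnion_le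
    _ ≤ ∑ t ∈ traces H P, 2 ^ m * Real.exp (-(ε ^ 2 * m / 2)) := by
        refine Finset.sum_le_sum fun t _ => ?_
        simpa [B] using card_sgn_sum_gt_le (v := fun i => lossGap (ind t) (T i))
          (fun i => abs_lossGap_le_one _ _) hε
    _ = (traces H P).card * (2 ^ m * Real.exp (-(ε ^ 2 * m / 2))) := by simp
    _ ≤ _ := by
        gcongr
        have h1 := card_traces_le hd P
        have h2 : (d + 1) * (P.card + 1) ^ d ≤ (d + 1) * (2 * m + 1) ^ d := by gcongr
        exact_mod_cast h1.trans h2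

variable {D : Measure (ℕ × Bool)} [IsProbabilityMeasure D]

theorem measurePreserving_swapUnless {m : ℕ} (σ : Fin m → Bool) :
    MeasurePreserving (fun (T : Fin m → (ℕ × Bool) × (ℕ × Bool)) i => swapUnless (σ i) (T i))
      (Measure.pi fun _ => D.prod D) (Measure.pi fun _ => D.prod D) := by
  refine measurePreserving_pi _ _ fun i => ?_
  cases σ i
  · exact Measure.measurePreserving_swap
  · exact MeasurePreserving.id _

/-- Each coordinatewise swap preserves the product measure, so the probability equals its average
over all `σ`; exchanging sum and integral leaves a count of signs for each fixed `T`. -/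
theorem measure_badDouble_le {H : HypothesisClass} {d : ℕ} (hd : NotShattered H (d + 1))
    {ε : ℝ} (hε : 0 ≤ ε) (m : ℕ) :
    Measure.pi (fun _ : Fin m => D.prod D) (badDouble H ε m) ≤
      ENNReal.ofReal ((d + 1) * (2 * m + 1) ^ d * Real.exp (-(ε ^ 2 * m / 2))) := by
  classical
  set μ := Measure.pi fun _ : Fin m => D.prod D
  set B := badDouble H ε m
  have h : (2 ^ m : ℝ≥0∞) * μ B ≤ 2 ^ m *
      ENNReal.ofReal ((d + 1) * (2 * m + 1) ^ d * Real.exp (-(ε ^ 2 * m / 2))) := by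
    calc (2 ^ m : ℝ≥0∞) * μ B
        = ∑ σ : Fin m → Bool, μ ((fun T i => swapUnless (σ i) (T i)) ⁻¹' B) := by
          rw [Finset.sum_congr rfl fun σ _ => (measurePreserving_swapUnless (D := D)
            σ).measure_preimage (MeasurableSet.of_discrete (s := B)).nullMeasurableSet]
          simp [μ]
      _ = ∫⁻ T, ∑ σ : Fin m → Bool,
            ((fun T i => swapUnless (σ i) (T i)) ⁻¹' B).indicator 1 T ∂μ := by
          rw [lintegral_finsetSum _ fun _ _ => Measurable.of_discrete]
          exact Finset.sum_congr rfl fun σ _ => (lintegral_indicator_one .of_discrete).symm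
      _ ≤ ∫⁻ _, ENNReal.ofReal
            ((d + 1) * (2 * m + 1) ^ d * (2 ^ m * Real.exp (-(ε ^ 2 * m / 2)))) ∂μ := by
          refine lintegral_mono fun T => ?_
          simp only [Set.indicator_apply, Pi.one_apply, Finset.sum_boole, Set.mem_preimage]
          rw [← ENNReal.ofReal_natCast]
          exact ENNReal.ofReal_le_ofReal (card_swap_mem_badDouble_le hd hε T)
      _ = _ := by
          rw [lintegral_const, measure_univ, mul_one, mul_left_comm,
            ENNReal.ofReal_mul (by positivity), ENNReal.ofReal_pow (by norm_num)]
          simp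
  exact (ENNReal.mul_le_mul_iff_right (by simp) (by simp)).1 h

end Symmetrization

/-! ### Empirical risk minimization learns classes of finite VC dimension -/

section EmpiricalRisk

/-- The number of errors of `h` on the sample `S`. -/
def empError (h : Hypothesis) (S : Sample) : ℕ := (S.map (loss h)).sum

theorem empError_ofFn {m : ℕ} (h : Hypothesis) (S : Fin m → ℕ × Bool) :
    empError h (List.ofFn S) = ∑ i, loss h (S i) := by
  rw [empError, List.map_ofFn, List.sum_ofFn]; rfl

/-- `A` outputs hypotheses of `H` which minimize the empirical error over `H`. -/
structure IsERM (A : Learner) (H : HypothesisClass) : Prop where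
  mem : ∀ S, A S ∈ H
  le : ∀ S, ∀ h ∈ H, empError (A S) S ≤ empError h S

theorem genError_eq_lintegral {D : Measure (ℕ × Bool)} (h : Hypothesis) : genError D h = ∫⁻ p, (loss h p : ℝ≥0∞) ∂D := by
  rw [genError, ← lintegral_indicator_one (Set.to_countable _).measurableSet]
  refine lintegral_congr fun p => ?_
  rcases p with ⟨x, y⟩
  simp only [Set.indicator_apply, loss, Set.mem_ofPred_eq, Pi.one_apply]
  cases h x <;> cases y <;> simp

variable {D : Measure (ℕ × Bool)} [IsProbabilityMeasure D]

theorem lintegral_sum_loss (m : ℕ) (h : Hypothesis) :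
    ∫⁻ S : Fin m → ℕ × Bool, ∑ i, (loss h (S i) : ℝ≥0∞) ∂(Measure.pi fun _ => D) =
      m * genError D h := by
  rw [lintegral_finsetSum _ fun _ _ => Measurable.of_discrete]
  have : ∀ i : Fin m, ∫⁻ S : Fin m → ℕ × Bool, (loss h (S i) : ℝ≥0∞) ∂(Measure.pi fun _ => D) =
      genError D h := fun i => by
    rw [genError_eq_lintegral]
    exact (measurePreserving_eval (fun _ : Fin m => D) i).lintegral_comp
      (f := fun p => (loss h p : ℝ≥0∞)) .of_discrete
  simp [this]

theorem lintegral_double {m : ℕ} (F : (Fin m → ℕ × Bool) → (Fin m → ℕ × Bool) → ℝ≥0∞) :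
    ∫⁻ T : Fin m → (ℕ × Bool) × (ℕ × Bool), F (fun i => (T i).1) (fun i => (T i).2)
        ∂(Measure.pi fun _ => D.prod D) =
      ∫⁻ S, ∫⁻ S', F S S' ∂(Measure.pi fun _ => D) ∂(Measure.pi fun _ => D) := by
  have h := (measurePreserving_arrowProdEquivProdArrow (ℕ × Bool) (ℕ × Bool) (Fin m)
    (fun _ => D) (fun _ => D)).lintegral_comp (f := fun q => F q.1 q.2) .of_discrete
  rw [lintegral_prod _ Measurable.of_discrete.aemeasurable] at h
  exact h

/-- Valid for all `h` in the class at once, hence also for a hypothesis chosen from the actual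
sample. -/
theorem sum_loss_ghost_le {H : HypothesisClass} {ε : ℝ} (hε : 0 ≤ ε) {m : ℕ}
    (T : Fin m → (ℕ × Bool) × (ℕ × Bool)) {h : Hypothesis} (hh : h ∈ H) :
    ∑ i, (loss h (T i).2 : ℝ≥0∞) ≤
      ∑ i, (loss h (T i).1 : ℝ≥0∞) + (ENNReal.ofReal ε * m + m * (badDouble H ε m).indicator 1 T) := by
  by_cases hT : T ∈ badDouble H ε m
  · rw [Set.indicator_of_mem hT]
    calc ∑ i, (loss h (T i).2 : ℝ≥0∞) ≤ ∑ i : Fin m, 1 :=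
          Finset.sum_le_sum fun i _ => by exact_mod_cast loss_le_one h _
      _ = m * 1 := by simp
      _ ≤ _ := le_add_self.trans le_add_self
  · rw [Set.indicator_of_notMem hT, mul_zero, add_zero]
    have hle : ∑ i, lossGap h (T i) ≤ ε * m := not_lt.1 fun hlt => hT ⟨h, hh, hlt⟩
    have hreal : ((∑ i, loss h (T i).2 : ℕ) : ℝ) ≤ (∑ i, loss h (T i).1 : ℕ) + ε * m := by
      simp only [lossGap, Finset.sum_sub_distrib] at hle
      push_cast
      linarith
    have := ENNReal.ofReal_le_ofReal hreal
    rw [ENNReal.ofReal_add (by positivity) (by positivity), ENNReal.ofReal_mul hε,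
      ENNReal.ofReal_natCast, ENNReal.ofReal_natCast, ENNReal.ofReal_natCast] at this
    exact_mod_cast this

/-- The expected error of an empirical risk minimizer. -/
theorem IsERM.lintegral_genError_le {A : Learner} {H : HypothesisClass} (hA : IsERM A H) {ε : ℝ}
    (hε : 0 ≤ ε) {m : ℕ} (hm : m ≠ 0) :
    ∫⁻ S : Fin m → ℕ × Bool, genError D (A (List.ofFn S)) ∂(Measure.pi fun _ => D) ≤
      (⨅ h ∈ H, genError D h) + (ENNReal.ofReal ε +
        Measure.pi (fun _ : Fin m => D.prod D) (badDouble H ε m)) := by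
  set μ := Measure.pi fun _ : Fin m => D
  set ν := Measure.pi fun _ : Fin m => D.prod D
  rw [ENNReal.iInf_add]
  refine le_iInf fun h => ?_
  rw [ENNReal.iInf_add]
  refine le_iInf fun hh => ?_
  -- After scaling by m, the left side is an expected ghost error. It is passed to the actual
  -- sample, where minimality replaces `A S` by the fixed `h`, whose expected number of errors is
  -- known exactly; so a one-sided deviation bound suffices.
  refine (ENNReal.mul_le_mul_iff_right (a := (m : ℝ≥0∞)) (by simpa using hm) (by simp)).1 ?_
  calc (m : ℝ≥0∞) * ∫⁻ S : Fin m → ℕ × Bool, genError D (A (List.ofFn S)) ∂μ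
      = ∫⁻ S : Fin m → ℕ × Bool, ∫⁻ S' : Fin m → ℕ × Bool,
          ∑ i, (loss (A (List.ofFn S)) (S' i) : ℝ≥0∞) ∂μ ∂μ := by
        simp_rw [μ, lintegral_sum_loss]
        rw [lintegral_const_mul _ Measurable.of_discrete]
    _ = ∫⁻ T : Fin m → (ℕ × Bool) × (ℕ × Bool),
          ∑ i, (loss (A (List.ofFn fun j => (T j).1)) (T i).2 : ℝ≥0∞) ∂ν :=
        (lintegral_double fun S S' => ∑ i, (loss (A (List.ofFn S)) (S' i) : ℝ≥0∞)).symm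
    _ ≤ ∫⁻ T : Fin m → (ℕ × Bool) × (ℕ × Bool), (∑ i, (loss h (T i).1 : ℝ≥0∞) +
          (ENNReal.ofReal ε * m + m * (badDouble H ε m).indicator 1 T)) ∂ν := by
        refine lintegral_mono fun T => (sum_loss_ghost_le hε T (hA.mem _)).trans ?_
        gcongr ?_ + _
        have := hA.le (List.ofFn fun j => (T j).1) h hh
        rw [empError_ofFn, empError_ofFn] at this
        exact_mod_cast this
    _ = m * genError D h + (ENNReal.ofReal ε * m + m * ν (badDouble H ε m)) := by
        rw [lintegral_add_left .of_discrete, lintegral_add_left .of_discrete,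
          lintegral_const_mul (m : ℝ≥0∞) Measurable.of_discrete, lintegral_indicator_one .of_discrete,
          lintegral_double fun S _ => ∑ i, (loss h (S i) : ℝ≥0∞)]
        simp [lintegral_sum_loss, ν]
    _ = _ := by ring

/-- An empirical risk minimizer succeeds as soon as the expected excess error is at most `1 / n²`. -/
theorem IsERM.succeeds {A : Learner} {H : HypothesisClass} (hA : IsERM A H) {n m : ℕ}
    (hn : n ≠ 0) (hm : m ≠ 0) {ε : ℝ} (hε : 0 ≤ ε)
    (hbad : ∀ D : Measure (ℕ × Bool), IsProbabilityMeasure D → ENNReal.ofReal ε +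
        Measure.pi (fun _ : Fin m => D.prod D) (badDouble H ε m) ≤ 1 / n * (1 / n)) :
    Succeeds A H n m := by
  intro D hD
  set μ := Measure.pi fun _ : Fin m => D
  set I := ⨅ h ∈ H, genError D h
  have hIle : ∀ S, I ≤ genError D (A S) := fun S => iInf₂_le (A S) (hA.mem S)
  -- The class contains `A []`, so the infimum is finite and can be subtracted. By properness the
  -- excess is nonnegative, and Markov's inequality applies to it.
  have hI : I ≠ ∞ := ne_top_of_le_ne_top ENNReal.one_ne_top ((hIle []).trans prob_le_one)
  set G : Set (Fin m → ℕ × Bool) :=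
    {S | genError D (A (List.ofFn S)) ≤ I + 1 / (n : ℝ≥0∞)} with hG
  have hn' : (1 / n : ℝ≥0∞) ≠ 0 := by simp
  have hn'' : (1 / n : ℝ≥0∞) ≠ ∞ := by simpa using hn
  have hexcess : ∫⁻ S : Fin m → ℕ × Bool, (genError D (A (List.ofFn S)) - I) ∂μ ≤
      1 / n * (1 / n) := by
    rw [lintegral_sub .of_discrete (by simpa [μ] using hI)
      (Filter.Eventually.of_forall fun S => hIle _),
      lintegral_const, measure_univ, mul_one]
    exact tsub_le_iff_left.2 ((hA.lintegral_genError_le hε hm).trans (by gcongr; exact hbad D hD))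
  have hGc : μ Gᶜ ≤ 1 / n := by
    refine (ENNReal.mul_le_mul_iff_right hn' hn'').1 (le_trans ?_ hexcess)
    refine le_trans ?_ (mul_meas_ge_le_lintegral .of_discrete (1 / (n : ℝ≥0∞)))
    gcongr
    intro S hS
    have : I + 1 / (n : ℝ≥0∞) < genError D (A (List.ofFn S)) := not_le.1 hS
    exact ENNReal.le_sub_of_add_le_left hI this.le
  rw [← compl_compl G, prob_compl_eq_one_sub .of_discrete]
  exact tsub_le_tsub_left hGc _

/-- A polynomial sample size sufficient for empirical risk minimization. -/
def sampleSize (d n : ℕ) : ℕ :=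
  2 * (d + 1) * 3 ^ d * (d + 1).factorial * 8 ^ (d + 1) * n ^ (4 * (d + 1) + 2)

theorem sampleSize_pos (d : ℕ) {n : ℕ} (hn : 1 ≤ n) : 0 < sampleSize d n := by
  have : 0 < (d + 1).factorial := Nat.factorial_pos _
  unfold sampleSize; positivity

/-- With ε = 1/(2n²) the exponent is −y for y = m/(8n⁴). Since exp(−y) ≤ (d+1)!/y^(d+1), one power
of m survives in the denominator against the growth of degree d; `sampleSize` collects the remaining
constants. -/
theorem growth_mul_exp_le {d n m : ℕ} (hn : 1 ≤ n) (hm : sampleSize d n ≤ m) :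
    ((d + 1) * (2 * m + 1) ^ d * Real.exp (-((1 / (2 * n ^ 2)) ^ 2 * m / 2)) : ℝ) ≤
      1 / (2 * n ^ 2) := by
  have hm1 : 1 ≤ m := (sampleSize_pos d hn).trans_le hm
  have hmR : (1 : ℝ) ≤ m := by exact_mod_cast hm1
  have hnR : (1 : ℝ) ≤ n := by exact_mod_cast hn
  have hfac : (0 : ℝ) < (d + 1).factorial := by exact_mod_cast Nat.factorial_pos _
  set y : ℝ := m / (8 * n ^ 4) with hy
  have hy0 : 0 < y := by positivity
  have hexp : Real.exp (-((1 / (2 * n ^ 2)) ^ 2 * m / 2)) ≤ (d + 1).factorial / y ^ (d + 1) := by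
    have he : -((1 / (2 * n ^ 2)) ^ 2 * m / 2 : ℝ) = -y := by rw [hy]; field_simp; norm_num
    rw [he, Real.exp_neg, inv_le_comm₀ (Real.exp_pos _) (by positivity), inv_div]
    exact Real.pow_div_factorial_le_exp y hy0.le _
  have hmS : (2 * (d + 1) * 3 ^ d * (d + 1).factorial * 8 ^ (d + 1) * n ^ (4 * (d + 1) + 2) : ℝ)
      ≤ m := by
    have : ((sampleSize d n : ℕ) : ℝ) ≤ m := by exact_mod_cast hm
    simpa [sampleSize] using this
  calc ((d + 1) * (2 * m + 1) ^ d * Real.exp (-((1 / (2 * n ^ 2)) ^ 2 * m / 2)) : ℝ)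
      ≤ (d + 1) * (3 * m) ^ d * ((d + 1).factorial / y ^ (d + 1)) := by
        gcongr; linarith
    _ = (2 * (d + 1) * 3 ^ d * (d + 1).factorial * 8 ^ (d + 1) * n ^ (4 * (d + 1) + 2)) /
          (2 * n ^ 2 * m) := by
        rw [hy, div_pow, mul_pow, mul_pow, ← pow_mul]; field_simp; ring
    _ ≤ m / (2 * n ^ 2 * m) := by gcongr
    _ = 1 / (2 * n ^ 2) := by field_simp

theorem IsERM.succeeds_of_sampleSize_le {A : Learner} {H : HypothesisClass} (hA : IsERM A H)
    {d : ℕ} (hd : NotShattered H (d + 1)) {n m : ℕ} (hn : 1 ≤ n) (hm : sampleSize d n ≤ m) :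
    Succeeds A H n m := by
  refine hA.succeeds (by omega) ((sampleSize_pos d hn).trans_le hm).ne'
    (ε := 1 / (2 * n ^ 2)) (by positivity) fun D hD => ?_
  have hnR : (0 : ℝ) < n := by exact_mod_cast hn
  calc ENNReal.ofReal (1 / (2 * n ^ 2)) +
        Measure.pi (fun _ : Fin m => D.prod D) (badDouble H (1 / (2 * n ^ 2)) m)
      ≤ ENNReal.ofReal (1 / (2 * n ^ 2)) + ENNReal.ofReal (1 / (2 * n ^ 2)) := by
        gcongr
        exact (measure_badDouble_le hd (by positivity) m).trans
          (ENNReal.ofReal_le_ofReal (growth_mul_exp_le hn hm))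
    _ = ENNReal.ofReal (1 / n * (1 / n)) := by
        rw [← ENNReal.ofReal_add (by positivity) (by positivity)]
        congr 1; field_simp; norm_num
    _ = 1 / n * (1 / n) := by
        rw [ENNReal.ofReal_mul (by positivity), ENNReal.ofReal_div_of_pos hnR]
        simp

end EmpiricalRisk

/-! ### The enlarged class -/

section ForcedClass

/-- The hypotheses which avoid the labelling `W` on the first `k + 1` points of every increasing
tuple of `k + 2` points whose last point is labelled `1`. -/
def forcedClass {k : ℕ} (W : (Fin (k + 1) → ℕ) → Fin (k + 1) → Bool) : HypothesisClass :=
  {h | ∀ z : Fin (k + 2) → ℕ, StrictMono z → h (z (Fin.last _)) = true →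
    (fun i : Fin (k + 1) => h (z i.castSucc)) ≠ W fun i => z i.castSucc}

variable {k : ℕ} {W : (Fin (k + 1) → ℕ) → Fin (k + 1) → Bool}

/-- The missing labelling of k + 2 points is `W` on the first k + 1 and 1 on the last. -/
theorem notShattered_forcedClass : NotShattered (forcedClass W) (k + 1 + 1) := by
  intro s hs
  let z : Fin (k + 2) ↪o ℕ := s.orderEmbOfFin hs
  have hz : ∀ i, z i ∈ s := fun i => s.orderEmbOfFin_mem hs i
  refine ⟨s.filter fun x => x = z (Fin.last _) ∨
    ∃ i : Fin (k + 1), x = z i.castSucc ∧ W (fun j => z j.castSucc) i = true,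
    Finset.filter_subset _ _, fun h hh heq => ?_⟩
  have hiff : ∀ i, h (z i) = true ↔ z i = z (Fin.last _) ∨
      ∃ j : Fin (k + 1), z i = z j.castSucc ∧ W (fun j => z j.castSucc) j = true := fun i => by
    have := congrArg (z i ∈ ·) heq
    simpa [hz i] using this
  refine hh z z.strictMono ((hiff _).2 (Or.inl rfl)) (funext fun i => ?_)
  rw [Bool.eq_iff_iff, hiff]
  simp only [EmbeddingLike.apply_eq_iff_eq, Fin.castSucc_inj, (Fin.castSucc_lt_last i).ne,
    false_or]
  exact ⟨by rintro ⟨j, rfl, hj⟩; exact hj, fun h => ⟨i, rfl, h⟩⟩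

/-- A constraint is active only if the last point is still labelled 1; then the whole tuple lies
below `M`, where nothing has changed. -/
theorem truncate_mem_forcedClass {h : Hypothesis} (hh : h ∈ forcedClass W) (M : ℕ) :
    (fun x => decide (x < M) && h x) ∈ forcedClass W := by
  intro z hz hlast heq
  simp only [Bool.and_eq_true, decide_eq_true_eq] at hlast
  refine hh z hz hlast.2 (Eq.trans (funext fun i => ?_) heq)
  have : z i.castSucc < M := (hz (Fin.castSucc_lt_last i)).trans hlast.1
  simp [this]

/-- Every hypothesis supported below `M` is the sequence of bits of a number below `2 ^ M`. -/
theorem exists_testBit_eq (h : Hypothesis) (M : ℕ) :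
    ∃ t < 2 ^ M, t.testBit = fun x => decide (x < M) && h x := by
  refine ⟨Nat.ofBits fun i : Fin M => h i, Nat.ofBits_lt_two_pow _, funext fun x => ?_⟩
  rw [Nat.testBit_ofBits]
  by_cases hx : x < M <;> simp [hx]

theorem zero_mem_forcedClass : Nat.testBit 0 ∈ forcedClass W := by
  intro z _ h; simp at h

/-- This makes membership decidable: an active constraint has bit 1 at its last point, and a
position of a 1 in `t` is less than `t`. -/
theorem testBit_mem_forcedClass_iff {t : ℕ} : t.testBit ∈ forcedClass W ↔
    ∀ z : Fin (k + 2) → ℕ, (∀ i, z i < t) → StrictMono z → t.testBit (z (Fin.last _)) = true →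
      (fun i : Fin (k + 1) => t.testBit (z i.castSucc)) ≠ W fun i => z i.castSucc := by
  refine ⟨fun h z _ => h z, fun h z hz hlast => h z (fun i => ?_) hz hlast⟩
  refine (hz.monotone (Fin.le_last i)).trans_lt ?_
  by_contra! hle
  have := Nat.testBit_lt_two_pow (hle.trans_lt Nat.lt_two_pow_self)
  simp [this] at hlast

open scoped Classical in
theorem computable_testBit_mem_forcedClass (hW : Computable W) :
    Computable fun t : ℕ => decide (t.testBit ∈ forcedClass W) := by
  let bit : (Fin (k + 2) × Fin (k + 2)) ⊕ Fin (k + 2) ⊕ Fin (k + 1) →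
      ℕ × (Fin (k + 2) → ℕ) → Bool
    | .inl (i, j), q => decide (q.2 i < q.2 j)
    | .inr (.inl i), q => q.1.testBit (q.2 i)
    | .inr (.inr i), q => W (fun j => q.2 j.castSucc) i
  have happ : ∀ i, Computable fun q : ℕ × (Fin (k + 2) → ℕ) => q.2 i := fun i =>
    computable_fin_apply Computable.snd i
  have hbit : ∀ s, Computable (bit s)
    | .inl (i, j) => Primrec.nat_lt.decide.to_comp.comp (happ i) (happ j)
    | .inr (.inl i) => primrec_testBit.to_comp.comp Computable.fst (happ i)
    | .inr (.inr i) => computable_fin_apply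
        (hW.comp (computable_fin_lam fun j => happ j.castSucc)) i
  have hp := computable_of_table hbit fun T => decide
    ((∀ i j, i < j → T (.inl (i, j)) = true) → T (.inr (.inl (Fin.last _))) = true →
      (fun i : Fin (k + 1) => T (.inr (.inl i.castSucc))) ≠ fun i => T (.inr (.inr i)))
  have hp' : Computable fun q : ℕ × (Fin (k + 2) → ℕ) => decide
      (StrictMono q.2 → q.1.testBit (q.2 (Fin.last _)) = true →
        (fun i : Fin (k + 1) => q.1.testBit (q.2 i.castSucc)) ≠ W fun i => q.2 i.castSucc) :=
    hp.of_eq fun q => by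
      simp only [bit, decide_eq_true_eq, StrictMono]
      congr
  refine (computable_decide_forall_fin hp'.to₂ Computable.id).of_eq fun t => ?_
  rw [Bool.eq_iff_iff]
  simp only [decide_eq_true_eq, testBit_mem_forcedClass_iff, id]

end ForcedClass

/-! ### The computable learner for the enlarged class -/

section Learner

/-- A number exceeding all the points of a sample. -/
def sampleBound (S : Sample) : ℕ := S.foldr (fun p n => max (p.1 + 1) n) 0

theorem lt_sampleBound {S : Sample} {p : ℕ × Bool} (hp : p ∈ S) : p.1 < sampleBound S := by
  induction S with
  | nil => simp at hp
  | cons q S ih =>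
    simp only [sampleBound, List.foldr_cons, lt_max_iff]
    rcases List.mem_cons.1 hp with rfl | h
    · exact Or.inl (Nat.lt_succ_self _)
    · exact Or.inr (ih h)

theorem primrec_sampleBound : Primrec sampleBound :=
  Primrec.list_foldr Primrec.id (Primrec.const 0)
    (Primrec.nat_max.comp (Primrec.succ.comp (Primrec.fst.comp (Primrec.fst.comp Primrec.snd)))
      (Primrec.snd.comp Primrec.snd)).to₂

theorem primrec_empError_testBit : Primrec₂ fun (t : ℕ) (S : Sample) => empError t.testBit S := by
  have hloss : Primrec₂ fun (t : ℕ) (p : ℕ × Bool) => loss t.testBit p :=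
    (Primrec.dom_finite fun b : Bool × Bool => (b.1 ^^ b.2).toNat).comp
      ((primrec_testBit.comp Primrec.fst (Primrec.fst.comp Primrec.snd)).pair
        (Primrec.snd.comp Primrec.snd))
  have h : Primrec fun q : ℕ × Sample =>
      q.2.foldr (fun p n => loss q.1.testBit p + n) 0 :=
    Primrec.list_foldr Primrec.snd (Primrec.const 0)
      (Primrec.nat_add.comp (hloss.comp (Primrec.fst.comp Primrec.fst)
        (Primrec.fst.comp Primrec.snd)) (Primrec.snd.comp Primrec.snd)).to₂
  refine h.of_eq fun q => ?_
  simp only [empError]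
  induction q.2 with
  | nil => rfl
  | cons p S ih => simp [ih]

/-- The first minimizer of the empirical error among the numbers below `N` satisfying `V`. -/
def bestBelow (V : ℕ → Bool) (S : Sample) (N : ℕ) : ℕ :=
  Nat.rec 0 (fun t b =>
    bif V t && decide (empError t.testBit S < empError b.testBit S) then t else b) N

theorem bestBelow_succ (V : ℕ → Bool) (S : Sample) (N : ℕ) : bestBelow V S (N + 1) =
    bif V N && decide (empError N.testBit S < empError (bestBelow V S N).testBit S) then N
      else bestBelow V S N := rfl

theorem apply_bestBelow {V : ℕ → Bool} (h0 : V 0 = true) (S : Sample) (N : ℕ) :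
    V (bestBelow V S N) = true := by
  induction N with
  | zero => exact h0
  | succ N ih =>
    rw [bestBelow_succ]
    cases hV : V N && decide (empError N.testBit S < empError (bestBelow V S N).testBit S)
    · exact ih
    · exact (Bool.and_eq_true_iff.1 hV).1

theorem empError_bestBelow_le {V : ℕ → Bool} {S : Sample} {N t : ℕ} (ht : t < N)
    (hV : V t = true) : empError (bestBelow V S N).testBit S ≤ empError t.testBit S := by
  induction N with
  | zero => omega
  | succ N ih =>
    rw [bestBelow_succ]
    by_cases hlt : V N = true ∧ empError N.testBit S < empError (bestBelow V S N).testBit S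
    · simp only [hlt.1, hlt.2, decide_true, Bool.and_true, cond_true]
      rcases Nat.lt_succ_iff_lt_or_eq.1 ht with h | rfl
      · exact hlt.2.le.trans (ih h)
      · exact le_rfl
    · have : (V N && decide (empError N.testBit S < empError (bestBelow V S N).testBit S)) =
          false := by
        rw [← Bool.not_eq_true, Bool.and_eq_true_iff, decide_eq_true_eq]; exact hlt
      rw [this, cond_false]
      rcases Nat.lt_succ_iff_lt_or_eq.1 ht with h | rfl
      · exact ih h
      · exact not_lt.1 fun h => hlt ⟨hV, h⟩

theorem computable_bestBelow {V : ℕ → Bool} (hV : Computable V) :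
    Computable fun q : Sample × ℕ => bestBelow V q.1 q.2 := by
  have ht : Computable fun r : (Sample × ℕ) × (ℕ × ℕ) => r.2.1 :=
    Computable.fst.comp Computable.snd
  have hb : Computable fun r : (Sample × ℕ) × (ℕ × ℕ) => r.2.2 :=
    Computable.snd.comp Computable.snd
  have hS : Computable fun r : (Sample × ℕ) × (ℕ × ℕ) => r.1.1 :=
    Computable.fst.comp Computable.fst
  have hE := primrec_empError_testBit.to_comp
  exact Computable.nat_rec Computable.snd (Computable.const 0)
    (Computable.cond (Primrec.and.to_comp.comp (hV.comp ht)
      (Primrec.nat_lt.decide.to_comp.comp (hE.comp ht hS) (hE.comp hb hS))) ht hb).to₂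

variable {k : ℕ} {W : (Fin (k + 1) → ℕ) → Fin (k + 1) → Bool}

open scoped Classical in
/-- Empirical risk minimization over the finitely supported hypotheses of the class. -/
def forcedLearner (W : (Fin (k + 1) → ℕ) → Fin (k + 1) → Bool) : Learner := fun S =>
  (bestBelow (fun t => decide (t.testBit ∈ forcedClass W)) S (2 ^ sampleBound S)).testBit

/-- Truncation at `sampleBound S` keeps a hypothesis in the class and does not alter its errors on
`S`, so searching the numbers below 2 ^ `sampleBound S` loses nothing. The default output 0 is
legitimate because the zero hypothesis is in the class. -/
theorem isERM_forcedLearner : IsERM (forcedLearner W) (forcedClass W) where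
  mem S := by
    classical
    exact of_decide_eq_true (apply_bestBelow
      (V := fun t => decide (t.testBit ∈ forcedClass W)) (decide_eq_true zero_mem_forcedClass) S _)
  le S h hh := by
    classical
    obtain ⟨t, ht, hth⟩ := exists_testBit_eq h (sampleBound S)
    have hmem : t.testBit ∈ forcedClass W := hth ▸ truncate_mem_forcedClass hh _
    refine (empError_bestBelow_le ht (decide_eq_true hmem)).trans_eq ?_
    rw [empError, empError, hth]
    congr 1
    refine List.map_congr_left fun p hp => ?_
    simp [loss, lt_sampleBound hp]

theorem isComputableLearner_forcedLearner (hW : Computable W) :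
    IsComputableLearner (forcedLearner W) := by
  classical
  have hN : Computable fun S : Sample => 2 ^ sampleBound S :=
    (primrec_two_pow.comp primrec_sampleBound).to_comp
  have hbest : Computable fun S : Sample =>
      bestBelow (fun t => decide (t.testBit ∈ forcedClass W)) S (2 ^ sampleBound S) :=
    (computable_bestBelow (computable_testBit_mem_forcedClass hW)).comp (Computable.id.pair hN)
  refine isComputableLearner_of_computable₂ ?_
  exact primrec_testBit.to_comp.comp (hbest.comp Computable.fst) Computable.snd

theorem primrec_sampleSize (d : ℕ) : Primrec (sampleSize d) := by
  have hpow : ∀ q : ℕ, Primrec fun n : ℕ => n ^ q := fun q => by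
    induction q with
    | zero => exact Primrec.const 1
    | succ q ih => exact Primrec.nat_mul.comp ih Primrec.id
  exact Primrec.nat_mul.comp (Primrec.const _) (hpow _)

theorem properlySCPACLearnable_forcedClass (hW : Computable W) :
    ProperlySCPACLearnable (forcedClass W) := by
  have hs : ∀ n : ℕ, 1 ≤ n → ∀ m : ℕ, sampleSize (k + 1) n ≤ m →
      Succeeds (forcedLearner W) (forcedClass W) n m := fun n hn m hm =>
    isERM_forcedLearner.succeeds_of_sampleSize_le notShattered_forcedClass hn hm
  exact ⟨forcedLearner W, isComputableLearner_forcedLearner hW,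
    fun n hn => ⟨_, hs n hn⟩, isERM_forcedLearner.mem, sampleSize (k + 1),
    (primrec_sampleSize _).to_comp, fun n hn => Nat.sInf_le (hs n hn)⟩

end Learner

/-! ### From a witness to the enlarged class, and the equivalence -/

open scoped Classical in
/-- A computable witness extends to a computable function on all tuples. -/
theorem HasComputableWitness.exists_computable {H : HypothesisClass} {k : ℕ}
    (hH : HasComputableWitness H k) : ∃ W : (Fin (k + 1) → ℕ) → Fin (k + 1) → Bool, Computable W ∧
      ∀ x : Fin (k + 1) → ℕ, StrictMono x → ∀ h ∈ H, (fun i => h (x i)) ≠ W x := by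
  obtain ⟨w, hw, P, hP, hPw⟩ := hH
  let W : (Fin (k + 1) → ℕ) → Fin (k + 1) → Bool := fun x =>
    if hx : StrictMono x then w (OrderEmbedding.ofStrictMono x hx) else fun _ => false
  have hmono : Computable fun x : Fin (k + 1) → ℕ => decide (StrictMono x) := by
    have hbit : ∀ s : Fin (k + 1) × Fin (k + 1),
        Computable fun x : Fin (k + 1) → ℕ => decide (x s.1 < x s.2) := fun s =>
      Primrec.nat_lt.decide.to_comp.comp (computable_fin_apply Computable.id _)
        (computable_fin_apply Computable.id _)
    refine (computable_of_table hbit fun T => decide (∀ i j, i < j → T (i, j) = true)).of_eq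
      fun x => ?_
    simp only [decide_eq_true_eq, StrictMono]
  -- Monotonicity is tested before `P` is run, as `P` may diverge on tuples that are not increasing.
  refine ⟨W, (Partrec.cond hmono hP (Computable.const fun _ => false).partrec).of_eq fun x => ?_,
    fun x hx h hh => ?_⟩
  · by_cases hx : StrictMono x
    · simpa [W, hx] using hPw (OrderEmbedding.ofStrictMono x hx)
    · simp [W, hx]
  · simpa [W, hx] using hw (OrderEmbedding.ofStrictMono x hx) h hh

theorem HasComputableWitness.exists_properlySCPACLearnable {H : HypothesisClass} {k : ℕ}
    (hH : HasComputableWitness H k) :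
    ∃ H' : HypothesisClass, H ⊆ H' ∧ ProperlySCPACLearnable H' := by
  obtain ⟨W, hW, hWH⟩ := hH.exists_computable
  exact ⟨forcedClass W, fun h hh z hz _ => hWH _ (hz.comp (Fin.strictMono_castSucc)) h hh,
    properlySCPACLearnable_forcedClass hW⟩

end CPAC

end

theorem theorem3p5 (H : CPAC.HypothesisClass) :
    List.TFAE
      [CPAC.effectiveVCDim H < ⊤,
       CPAC.CPACLearnable H,
       ∃ H' : CPAC.HypothesisClass, H ⊆ H' ∧ CPAC.ProperlySCPACLearnable H'] := by
  tfae_have 1 → 3 := fun h => by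
    obtain ⟨k, hk⟩ := CPAC.effectiveVCDim_lt_top.1 h
    exact hk.exists_properlySCPACLearnable
  tfae_have 3 → 2 := fun ⟨_, hH, h⟩ =>
    CPAC.CPACLearnable.of_subset_of_properlySCPACLearnable hH h
  tfae_have 2 → 1 := fun h => CPAC.effectiveVCDim_lt_top.2 h.exists_hasComputableWitness
  tfae_finish
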